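/- \textbf{Theorem.} Let $X$ be a compact length space, i.e. a compact metric space (with finite distances) in which the distance $d(x,y)$ of any two points is the infimum of the lengths of the continuous paths from $x$ to $y$. Let $Y\subseteq X$ be a nonempty closed set, $F:Y\to\mathbb R$ a Lipschitz function, $\epsilon>0$ and $\theta\in(-1,1)$. The biased $\epsilon$-tug-of-war started at $x_0\in X$ is the following two-player game. At the $k$-th step ($k\ge 1$) a coin is tossed, independently of the earlier tosses, which player I wins with probability $\frac{1+\theta}{2}$ and player II wins otherwise; the winner chooses a point $x_k\in X$ with $d(x_k,x_{k-1})<\epsilon$. The game ends at the first time $\tau\ge 0$ with $x_\tau\in Y$, and player II then pays $F(x_\tau)$ to player I. A strategy of a player is a rule choosing that player's next move as a function of all previous coin tosses and moves. For strategies $\mathcal S_I,\mathcal S_{II}$ of the two players let $F_-(\mathcal S_I,\mathcal S_{II})=F_+(\mathcal S_I,\mathcal S_{II})=\mathbb E\,[F(x_\tau)]$ if $\tau<\infty$ almost surely, and $F_-(\mathcal S_I,\mathcal S_{II})=-\infty$, $F_+(\mathcal S_I,\mathcal S_{II})=+\infty$ otherwise. Define $$u_I^\epsilon(x_0)=\sup_{\mathcal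 S_I}\inf_{\mathcal S_{II}}F_-(\mathcal S_I,\mathcal S_{II}),\qquad u_{II}^\epsilon(x_0)=\inf_{\mathcal S_{II}}\sup_{\mathcal S_I}F_+(\mathcal S_I,\mathcal S_{II}).$$ Then the game has a value: $u_I^\epsilon(x_0)=u_{II}^\epsilon(x_0)$ for every $x_0\in X$. -/

import Mathlib

open MeasureTheory ProbabilityTheory

noncomputable section

/-- A metric space is a length space if the distance of any two points is the infimum of the
lengths (total variations) of the continuous paths joining them. -/
def IsLengthSpace (X : Type*) [MetricSpace X] : Prop :=
  ∀ x y : X, edist x y = ⨅ γ : Path x y, eVariationOn γ Set.univ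

namespace TugOfWar

/-- The record of the play so far, most recent round first. Each round is recorded by the result
of the coin toss (`true` if player I won it) and the position chosen by the winner. -/
abbrev History (X : Type*) := List (Bool × X)

/-- The current game position, given the starting position and the record of the play. -/
def current {X : Type*} (x₀ : X) : History X → X
  | [] => x₀
  | r :: _ => r.2

/-- A strategy for one of the players in the game with steps of length less than `ε`: it chooses
the player's next move as a function of the starting position and of all previous coin tosses and
moves, within distance less than `ε` of the current position. -/
structure Strategy (X : Type*) [MetricSpace X] (ε : ℝ) where
  move : X → History X → X
  dist_move_lt : ∀ (x₀ : X) (h : History X), dist (move x₀ h) (current x₀ h) < ε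

variable {X : Type*} [MetricSpace X] {ε : ℝ}

/-- The record of the first `n` rounds when the players use the strategies `S₁` and `S₂`, the
starting position is `x₀`, and the results of the coin tosses are `ω 0, ω 1, …`. -/
def history (S₁ S₂ : Strategy X ε) (x₀ : X) (ω : ℕ → Bool) : ℕ → History X
  | 0 => []
  | n + 1 =>
    (ω n, if ω n then S₁.move x₀ (history S₁ S₂ x₀ ω n) else S₂.move x₀ (history S₁ S₂ x₀ ω n))
      :: history S₁ S₂ x₀ ω n

/-- The position `xₙ` after `n` rounds. The sequence is continued after the first visit to the
terminal set; the later positions do not influence the payoff. -/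
def position (S₁ S₂ : Strategy X ε) (x₀ : X) (ω : ℕ → Bool) (n : ℕ) : X :=
  current x₀ (history S₁ S₂ x₀ ω n)

/-- The probability `(1 + θ) / 2` that player I wins a coin toss with bias `θ ∈ [-1, 1]`. -/
def winProb (θ : Set.Icc (-1 : ℝ) 1) : unitInterval :=
  ⟨(1 + (θ : ℝ)) / 2, by linarith [θ.2.1], by linarith [θ.2.2]⟩

/-- The law of an infinite sequence of independent tosses of the biased coin. -/
def coinMeasure (θ : Set.Icc (-1 : ℝ) 1) : Measure (ℕ → Bool) :=
  Measure.infinitePi fun _ : ℕ => bernoulliMeasure true false (winProb θ)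

open Classical in
/-- The payoff `F (x_τ)` of a play `x₀, x₁, …`, where `τ` is the first time at which the play is
in the terminal set `Y` (and `0`, a value that is never used, if there is no such time). -/
def payoff (Y : Set X) (F : Y → ℝ) (x : ℕ → X) : ℝ :=
  if h : ∃ n, x n ∈ Y then F ⟨x (Nat.find h), Nat.find_spec h⟩ else 0

/-- Under the given strategies, the game terminates with probability one. -/
def TerminatesAS (θ : Set.Icc (-1 : ℝ) 1) (Y : Set X) (S₁ S₂ : Strategy X ε) (x₀ : X) : Prop :=
  ∀ᵐ ω ∂(coinMeasure θ), ∃ n, position S₁ S₂ x₀ ω n ∈ Y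

/-- The expected payoff at the end of the game. -/
def expectedPayoff (θ : Set.Icc (-1 : ℝ) 1) (Y : Set X) (F : Y → ℝ) (S₁ S₂ : Strategy X ε)
    (x₀ : X) : ℝ :=
  ∫ ω, payoff Y F (position S₁ S₂ x₀ ω) ∂(coinMeasure θ)

open Classical in
/-- `F₋`: the expected payoff if the game terminates almost surely, and `-∞` otherwise. -/
def payoffMinus (θ : Set.Icc (-1 : ℝ) 1) (Y : Set X) (F : Y → ℝ) (S₁ S₂ : Strategy X ε)
    (x₀ : X) : EReal :=
  if TerminatesAS θ Y S₁ S₂ x₀ then (expectedPayoff θ Y F S₁ S₂ x₀ : EReal) else ⊥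

open Classical in
/-- `F₊`: the expected payoff if the game terminates almost surely, and `+∞` otherwise. -/
def payoffPlus (θ : Set.Icc (-1 : ℝ) 1) (Y : Set X) (F : Y → ℝ) (S₁ S₂ : Strategy X ε)
    (x₀ : X) : EReal :=
  if TerminatesAS θ Y S₁ S₂ x₀ then (expectedPayoff θ Y F S₁ S₂ x₀ : EReal) else ⊤

/-- The value function of player I. -/
def valueI (ε : ℝ) (θ : Set.Icc (-1 : ℝ) 1) (Y : Set X) (F : Y → ℝ) (x₀ : X) : EReal :=
  ⨆ S₁ : Strategy X ε, ⨅ S₂ : Strategy X ε, payoffMinus θ Y F S₁ S₂ x₀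

/-- The value function of player II. -/
def valueII (ε : ℝ) (θ : Set.Icc (-1 : ℝ) 1) (Y : Set X) (F : Y → ℝ) (x₀ : X) : EReal :=
  ⨅ S₂ : Strategy X ε, ⨆ S₁ : Strategy X ε, payoffPlus θ Y F S₁ S₂ x₀

end TugOfWar

end

/-! Let `p`, `q` be the winning probabilities of players I and II. Let `u x` be the supremum of the
payoffs that player I can guarantee from `x` by a strategy under which the game terminates almost
surely, and `v x` the infimum of the bounds that player II can enforce likewise. Then `u x ≤ valueI
≤ valueII ≤ v x`, so it suffices to prove `v ≤ u`.

Both functions are bounded: the length structure gives an integer rank that a player can lower by a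
legal move from any point off `Y`, and a player who always does so ends the game almost surely
(`stationary_terminates`). Playing a nearly optimal first move and then nearly optimal strategies
from the position reached (`Strategy.compose`) shows that, off `Y`, `v ≤ p sup v + q inf v` and `u ≥
p sup u + q inf u`, where sup and inf run over the `ε`-ball; on `Y`, `v ≤ u`.

The core is the comparison principle `le_of_subsolution_of_supersolution`. Suppose `M = sup (v - u)
> 0` and, by symmetry, `p ≤ q`. Where `v - u` is nearly `M`, a move that nearly maximizes `v` leads
again to such a point, and the upward slope `sup v - v` hardly drops; a slope bounded below would
thus make `v` unbounded (`exists_large_value`). So `v` is almost constant on balls around nearly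
maximal points, and then all points of such a ball are nearly maximal. Moves that lower the rank
lead from there to `Y`, where `v - u ≤ 0`: a contradiction. -/

namespace TugOfWar

/-! ### Self-similarity of the law of the coin tosses. -/

/-- The sequence of coin tosses that starts with `b` and continues with `ω`. -/
def prepend (b : Bool) (ω : ℕ → Bool) : ℕ → Bool
  | 0 => b
  | n + 1 => ω n

theorem measurable_prepend (b : Bool) : Measurable (prepend b) := by
  refine measurable_pi_iff.2 fun n => ?_
  cases n with
  | zero => exact measurable_const
  | succ n => exact measurable_pi_apply n

instance (θ : Set.Icc (-1 : ℝ) 1) : IsProbabilityMeasure (coinMeasure θ) := by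
  unfold coinMeasure; infer_instance

theorem prepend_preimage_pi (b : Bool) (s : Finset ℕ) (t : ℕ → Set Bool) :
    prepend b ⁻¹' (s : Set ℕ).pi t =
      {_ω | 0 ∈ s → b ∈ t 0} ∩
        (s.preimage Nat.succ Nat.succ_injective.injOn : Set ℕ).pi fun n => t (n + 1) := by
  ext ω
  simp only [Set.mem_preimage, Set.mem_pi, Finset.mem_coe, Set.mem_inter_iff, Set.mem_ofPred_eq,
    Finset.mem_preimage]
  constructor
  · exact fun h => ⟨h 0, fun n hn => h (n + 1) hn⟩
  · rintro ⟨h0, h⟩ (_ | n) hn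
    exacts [h0 hn, h n hn]

/-- Infinite product measures are determined by finite boxes, where the claim is the splitting of a
product into the factor at `0` and the shifted rest. All conditioning on the first toss rests on
this identity. -/
theorem coinMeasure_eq (θ : Set.Icc (-1 : ℝ) 1) :
    coinMeasure θ =
      unitInterval.toNNReal (winProb θ) • (coinMeasure θ).map (prepend true) +
      unitInterval.toNNReal (unitInterval.symm (winProb θ)) •
        (coinMeasure θ).map (prepend false) := by
  classical
  symm
  refine Measure.eq_infinitePi _ fun s t ht => ?_
  have hm : MeasurableSet ((s : Set ℕ).pi t) := .pi s.countable_toSet fun i _ => ht i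
  have hprod (f : ℕ → ENNReal) : ∏ i ∈ s, f i =
      (if 0 ∈ s then f 0 else 1) *
        ∏ i ∈ s.preimage Nat.succ Nat.succ_injective.injOn, f (i + 1) := by
    have h1 : ∏ i ∈ s.preimage Nat.succ Nat.succ_injective.injOn, f (i + 1) =
        ∏ i ∈ s.erase 0, f i := by
      refine Finset.prod_nbij Nat.succ ?_ Nat.succ_injective.injOn ?_ (fun _ _ => rfl)
      · simp
      · rintro (_ | n) hn
        · simp at hn
        · exact ⟨n, by simpa using hn, rfl⟩
    rw [h1]
    split_ifs with h
    · exact (Finset.mul_prod_erase s f h).symm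
    · rw [Finset.erase_eq_of_notMem h, one_mul]
  have hmap (b : Bool) : (coinMeasure θ).map (prepend b) ((s : Set ℕ).pi t) =
      (if 0 ∈ s → b ∈ t 0 then 1 else 0) *
        ∏ i ∈ s.preimage Nat.succ Nat.succ_injective.injOn,
          bernoulliMeasure true false (winProb θ) (t (i + 1)) := by
    rw [Measure.map_apply (measurable_prepend b) hm, prepend_preimage_pi]
    split_ifs with h
    · have huniv : {_ω : ℕ → Bool | 0 ∈ s → b ∈ t 0} = Set.univ := Set.eq_univ_of_forall fun _ => h
      rw [huniv, Set.univ_inter, one_mul]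
      exact Measure.infinitePi_pi (fun _ => bernoulliMeasure true false (winProb θ))
        fun i _ => ht (i + 1)
    · simp [h]
  rw [Measure.add_apply, Measure.smul_apply, Measure.smul_apply, hmap, hmap, hprod]
  simp only [ENNReal.smul_def, smul_eq_mul, ← mul_assoc, ← add_mul]
  congr 1
  by_cases h : 0 ∈ s
  · simp only [h, true_imp_iff, if_true]
    by_cases h1 : true ∈ t 0 <;> by_cases h2 : false ∈ t 0 <;>
      simp [h1, h2, bernoulliMeasure_def]
  · have h1 : bernoulliMeasure true false (winProb θ) Set.univ = 1 := measure_univ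
    simpa [h, bernoulliMeasure_def] using h1

theorem ae_coinMeasure_iff {θ : Set.Icc (-1 : ℝ) 1} (h₁ : 0 < winProb θ) (h₂ : winProb θ < 1)
    {P : (ℕ → Bool) → Prop} (hP : MeasurableSet {ω | P ω}) :
    (∀ᵐ ω ∂(coinMeasure θ), P ω) ↔ ∀ b, ∀ᵐ ω ∂(coinMeasure θ), P (prepend b ω) := by
  have h1 : unitInterval.toNNReal (winProb θ) ≠ 0 := by
    rw [ne_eq, ← NNReal.coe_inj]
    exact fun h => h₁.ne' (Subtype.ext h)
  have h2 : unitInterval.toNNReal (unitInterval.symm (winProb θ)) ≠ 0 := by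
    have : (winProb θ : ℝ) ≠ 1 := fun h => h₂.ne (Subtype.ext h)
    rw [ne_eq, ← NNReal.coe_inj]
    simpa [sub_eq_zero] using this.symm
  conv_lhs => rw [coinMeasure_eq]
  rw [ae_add_measure_iff, Measure.ae_smul_measure_iff h1, Measure.ae_smul_measure_iff h2,
    ae_map_iff (measurable_prepend _).aemeasurable hP,
    ae_map_iff (measurable_prepend _).aemeasurable hP, Bool.forall_bool, and_comm]

theorem integral_coinMeasure {θ : Set.Icc (-1 : ℝ) 1} {f : (ℕ → Bool) → ℝ} (hf : Measurable f)
    {C : ℝ} (hC : ∀ ω, |f ω| ≤ C) :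
    ∫ ω, f ω ∂(coinMeasure θ) = winProb θ * ∫ ω, f (prepend true ω) ∂(coinMeasure θ) +
      (1 - winProb θ) * ∫ ω, f (prepend false ω) ∂(coinMeasure θ) := by
  have hi (b : Bool) : Integrable f ((coinMeasure θ).map (prepend b)) := by
    have := Measure.isProbabilityMeasure_map (μ := coinMeasure θ)
      (measurable_prepend b).aemeasurable
    exact Integrable.of_bound hf.aestronglyMeasurable C (Filter.Eventually.of_forall hC)
  conv_lhs => rw [coinMeasure_eq]
  rw [integral_add_measure ((hi _).smul_measure_nnreal) ((hi _).smul_measure_nnreal),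
    integral_smul_nnreal_measure, integral_smul_nnreal_measure,
    integral_map (measurable_prepend _).aemeasurable hf.aestronglyMeasurable,
    integral_map (measurable_prepend _).aemeasurable hf.aestronglyMeasurable]
  simp [NNReal.smul_def]

theorem measureReal_coinMeasure (θ : Set.Icc (-1 : ℝ) 1) {s : Set (ℕ → Bool)}
    (hs : MeasurableSet s) :
    (coinMeasure θ).real s = winProb θ * (coinMeasure θ).real (prepend true ⁻¹' s) +
      (1 - winProb θ) * (coinMeasure θ).real (prepend false ⁻¹' s) := by
  have h := integral_coinMeasure (θ := θ) (f := s.indicator 1) (C := 1)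
    (measurable_one.indicator hs) fun ω => by by_cases h : ω ∈ s <;> simp [h]
  have hi (b : Bool) : (fun ω => s.indicator (1 : (ℕ → Bool) → ℝ) (prepend b ω)) =
      (prepend b ⁻¹' s).indicator 1 := rfl
  rwa [hi, hi, integral_indicator_one hs, integral_indicator_one (measurable_prepend _ hs),
    integral_indicator_one (measurable_prepend _ hs)] at h

/-- Such an `f` factors through a finite discrete space. This is why strategies may be arbitrary,
possibly non-measurable, functions. -/
theorem measurable_of_dependsOn_lt {β : Type*} [MeasurableSpace β] {f : (ℕ → Bool) → β} (n : ℕ)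
    (hf : ∀ ω ω' : ℕ → Bool, (∀ k < n, ω k = ω' k) → f ω = f ω') : Measurable f := by
  have : f = (fun a : Fin n → Bool => f fun k => if h : k < n then a ⟨k, h⟩ else true) ∘
      fun ω k => ω k := by
    ext ω
    exact hf _ _ fun k hk => by simp [hk]
  rw [this]
  exact (measurable_of_finite _).comp (measurable_pi_lambda _ fun k => measurable_pi_apply _)

/-! ### Payoffs and positions: locality and measurability. -/

section

variable {X : Type*}

theorem payoff_congr {Y : Set X} (F : Y → ℝ) {x x' : ℕ → X} {n : ℕ} (hn : x n ∈ Y)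
    (h : ∀ k ≤ n, x k = x' k) : payoff Y F x = payoff Y F x' := by
  classical
  have h1 : ∃ n, x n ∈ Y := ⟨n, hn⟩
  have h2 : ∃ n, x' n ∈ Y := ⟨n, h n le_rfl ▸ hn⟩
  have h3 : Nat.find h1 = Nat.find h2 := by
    refine le_antisymm (Nat.find_min' _ ?_) (Nat.find_min' _ ?_)
    · rw [h _ (Nat.find_min' _ (h n le_rfl ▸ hn))]; exact Nat.find_spec h2
    · rw [← h _ (Nat.find_min' _ hn)]; exact Nat.find_spec h1
  rw [payoff, payoff, dif_pos h1, dif_pos h2]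
  congr 2
  rw [← h3]
  exact h _ (Nat.find_min' _ hn)

theorem abs_payoff_le {Y : Set X} {F : Y → ℝ} {C : ℝ} (hC0 : 0 ≤ C) (hC : ∀ y, |F y| ≤ C)
    (x : ℕ → X) : |payoff Y F x| ≤ C := by
  unfold payoff
  split_ifs
  · exact hC _
  · simpa

theorem payoff_of_mem {Y : Set X} (F : Y → ℝ) {x : ℕ → X} (h : x 0 ∈ Y) :
    payoff Y F x = F ⟨x 0, h⟩ := by
  have := payoff_congr F (x' := fun _ => x 0) h (by simp)
  rw [this, payoff, dif_pos ⟨0, h⟩]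

theorem payoff_of_notMem {Y : Set X} (F : Y → ℝ) {x : ℕ → X} (h : x 0 ∉ Y) :
    payoff Y F x = payoff Y F fun n => x (n + 1) := by
  classical
  by_cases h1 : ∃ n, x n ∈ Y
  · have h2 : ∃ n, x (n + 1) ∈ Y := by
      obtain ⟨_ | n, hn⟩ := h1
      exacts [absurd hn h, ⟨n, hn⟩]
    have h3 : Nat.find h1 = Nat.find h2 + 1 := Nat.find_comp_succ h1 h2 h
    rw [payoff, payoff, dif_pos h1, dif_pos h2]
    simp only [h3]
  · rw [payoff, payoff, dif_neg h1, dif_neg fun ⟨n, hn⟩ => h1 ⟨_, hn⟩]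

theorem current_append (x₀ y : X) (b : Bool) (h : History X) :
    current x₀ (h ++ [(b, y)]) = current y h := by
  cases h <;> rfl

end

variable {X : Type*} [MetricSpace X] {ε : ℝ}

theorem history_congr_of_lt (S₁ S₂ : Strategy X ε) (x₀ : X) {ω ω' : ℕ → Bool} {n : ℕ}
    (h : ∀ k < n, ω k = ω' k) : history S₁ S₂ x₀ ω n = history S₁ S₂ x₀ ω' n := by
  induction n with
  | zero => rfl
  | succ n ih => simp only [history, ih fun k hk => h k (by omega), h n (by omega)]

theorem measurableSet_position_mem (Y : Set X) (S₁ S₂ : Strategy X ε) (x₀ : X) :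
    MeasurableSet {ω | ∃ n, position S₁ S₂ x₀ ω n ∈ Y} := by
  rw [show {ω | ∃ n, position S₁ S₂ x₀ ω n ∈ Y} = ⋃ n, {ω | position S₁ S₂ x₀ ω n ∈ Y} by
    ext; simp]
  refine .iUnion fun n => measurableSet_setOfPred.2 (measurable_of_dependsOn_lt n fun ω ω' h => ?_)
  simp only [position, history_congr_of_lt _ _ _ h]

open Classical in
theorem measurable_payoff (Y : Set X) (F : Y → ℝ) (S₁ S₂ : Strategy X ε) (x₀ : X) :
    Measurable fun ω => payoff Y F (position S₁ S₂ x₀ ω) := by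
  -- The payoff is the pointwise limit of truncations that depend on finitely many tosses.
  let f (n : ℕ) (ω : ℕ → Bool) : ℝ :=
    if ∃ k ≤ n, position S₁ S₂ x₀ ω k ∈ Y then payoff Y F (position S₁ S₂ x₀ ω) else 0
  refine measurable_of_tendsto_metrizable (f := f) (fun n => ?_) (tendsto_pi_nhds.2 fun ω => ?_)
  · refine measurable_of_dependsOn_lt n fun ω ω' h => ?_
    have hpos : ∀ k ≤ n, position S₁ S₂ x₀ ω k = position S₁ S₂ x₀ ω' k := fun k hk => by
      rw [position, position, history_congr_of_lt _ _ _ fun j hj => h j (by omega)]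
    have hiff : (∃ k ≤ n, position S₁ S₂ x₀ ω k ∈ Y) ↔ ∃ k ≤ n, position S₁ S₂ x₀ ω' k ∈ Y :=
      exists_congr fun k => and_congr_right fun hk => by rw [hpos k hk]
    simp only [f, hiff]
    split_ifs with h'
    · obtain ⟨k, hk, hkY⟩ := hiff.2 h'
      exact payoff_congr F hkY fun j hj => hpos j (hj.trans hk)
    · rfl
  · refine tendsto_atTop_of_eventually_const (i₀ := if h : ∃ n, position S₁ S₂ x₀ ω n ∈ Y then
      Nat.find h else 0) fun n hn => ?_
    by_cases h : ∃ n, position S₁ S₂ x₀ ω n ∈ Y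
    · rw [dif_pos h] at hn
      exact if_pos ⟨_, hn, Nat.find_spec h⟩
    · simp only [f]
      rw [if_neg fun ⟨k, _, hk⟩ => h ⟨k, hk⟩, payoff, dif_neg h]

/-! ### Conditioning on the first round -/

/-- The strategy for the rest of the game after a first round won by the player that `b`
indicates, starting from `x₀`. -/
def Strategy.shift (S : Strategy X ε) (b : Bool) (x₀ : X) : Strategy X ε where
  move y h := S.move x₀ (h ++ [(b, y)])
  dist_move_lt y h := by simpa [current_append] using S.dist_move_lt x₀ (h ++ [(b, y)])

/-- The position after the first round. -/
def firstMove (S₁ S₂ : Strategy X ε) (x₀ : X) (b : Bool) : X :=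
  if b then S₁.move x₀ [] else S₂.move x₀ []

theorem history_prepend (S₁ S₂ : Strategy X ε) (x₀ : X) (b : Bool) (ω : ℕ → Bool) (n : ℕ) :
    history S₁ S₂ x₀ (prepend b ω) (n + 1) =
      history (S₁.shift b x₀) (S₂.shift b x₀) (firstMove S₁ S₂ x₀ b) ω n ++
        [(b, firstMove S₁ S₂ x₀ b)] := by
  induction n with
  | zero => rfl
  | succ n ih =>
    rw [history, ih]
    rfl

theorem position_prepend (S₁ S₂ : Strategy X ε) (x₀ : X) (b : Bool) (ω : ℕ → Bool) (n : ℕ) :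
    position S₁ S₂ x₀ (prepend b ω) (n + 1) =
      position (S₁.shift b x₀) (S₂.shift b x₀) (firstMove S₁ S₂ x₀ b) ω n := by
  rw [position, history_prepend, current_append, position]

/-- A shifted composed strategy agrees with the intended one only from a given starting point, so
equality of the strategies themselves would be too much to ask. -/
theorem position_congr {S₁ S₂ S₁' S₂' : Strategy X ε} {x₀ : X} (h₁ : S₁.move x₀ = S₁'.move x₀)
    (h₂ : S₂.move x₀ = S₂'.move x₀) : position S₁ S₂ x₀ = position S₁' S₂' x₀ := by
  have (ω : ℕ → Bool) (n : ℕ) : history S₁ S₂ x₀ ω n = history S₁' S₂' x₀ ω n := by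
    induction n with
    | zero => rfl
    | succ n ih => simp only [history, ih, h₁, h₂]
  ext ω n
  rw [position, position, this]

theorem terminatesAS_of_mem (θ : Set.Icc (-1 : ℝ) 1) {Y : Set X} (S₁ S₂ : Strategy X ε) {x₀ : X}
    (h : x₀ ∈ Y) : TerminatesAS θ Y S₁ S₂ x₀ :=
  .of_forall fun _ => ⟨0, h⟩

theorem expectedPayoff_of_mem (θ : Set.Icc (-1 : ℝ) 1) {Y : Set X} (F : Y → ℝ)
    (S₁ S₂ : Strategy X ε) {x₀ : X} (h : x₀ ∈ Y) :
    expectedPayoff θ Y F S₁ S₂ x₀ = F ⟨x₀, h⟩ := by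
  have (ω : ℕ → Bool) : payoff Y F (position S₁ S₂ x₀ ω) = F ⟨x₀, h⟩ := payoff_of_mem F h
  simp [expectedPayoff, this]

theorem exists_position_prepend_iff {Y : Set X} (S₁ S₂ : Strategy X ε) {x₀ : X} (h : x₀ ∉ Y)
    (b : Bool) (ω : ℕ → Bool) :
    (∃ n, position S₁ S₂ x₀ (prepend b ω) n ∈ Y) ↔
      ∃ n, position (S₁.shift b x₀) (S₂.shift b x₀) (firstMove S₁ S₂ x₀ b) ω n ∈ Y := by
  simp only [← position_prepend]
  constructor
  · rintro ⟨_ | n, hn⟩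
    exacts [absurd hn h, ⟨n, hn⟩]
  · exact fun ⟨n, hn⟩ => ⟨_, hn⟩

theorem terminatesAS_iff {θ : Set.Icc (-1 : ℝ) 1} (h₁ : 0 < winProb θ) (h₂ : winProb θ < 1)
    {Y : Set X} (S₁ S₂ : Strategy X ε) {x₀ : X} (h : x₀ ∉ Y) :
    TerminatesAS θ Y S₁ S₂ x₀ ↔ ∀ b, TerminatesAS θ Y (S₁.shift b x₀) (S₂.shift b x₀)
      (firstMove S₁ S₂ x₀ b) := by
  simp only [TerminatesAS]
  rw [ae_coinMeasure_iff h₁ h₂ (measurableSet_position_mem Y S₁ S₂ x₀)]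
  simp only [exists_position_prepend_iff S₁ S₂ h]

theorem expectedPayoff_eq (θ : Set.Icc (-1 : ℝ) 1) {Y : Set X} {F : Y → ℝ} {C : ℝ} (hC0 : 0 ≤ C)
    (hC : ∀ y, |F y| ≤ C) (S₁ S₂ : Strategy X ε) {x₀ : X} (h : x₀ ∉ Y) :
    expectedPayoff θ Y F S₁ S₂ x₀ =
      winProb θ * expectedPayoff θ Y F (S₁.shift true x₀) (S₂.shift true x₀) (S₁.move x₀ []) +
      (1 - winProb θ) *
        expectedPayoff θ Y F (S₁.shift false x₀) (S₂.shift false x₀) (S₂.move x₀ []) := by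
  have (b : Bool) (ω : ℕ → Bool) : payoff Y F (position S₁ S₂ x₀ (prepend b ω)) =
      payoff Y F (position (S₁.shift b x₀) (S₂.shift b x₀) (firstMove S₁ S₂ x₀ b) ω) := by
    rw [payoff_of_notMem F (x := position S₁ S₂ x₀ (prepend b ω)) h]
    simp only [position_prepend]
  rw [expectedPayoff, integral_coinMeasure (measurable_payoff Y F S₁ S₂ x₀)
    fun ω => abs_payoff_le hC0 hC _]
  simp only [this]
  rfl

theorem abs_expectedPayoff_le (θ : Set.Icc (-1 : ℝ) 1) {Y : Set X} {F : Y → ℝ} {C : ℝ}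
    (hC0 : 0 ≤ C) (hC : ∀ y, |F y| ≤ C) (S₁ S₂ : Strategy X ε) (x₀ : X) :
    |expectedPayoff θ Y F S₁ S₂ x₀| ≤ C := by
  have := norm_integral_le_of_norm_le_const (μ := coinMeasure θ) (C := C)
    (f := fun ω => payoff Y F (position S₁ S₂ x₀ ω)) (.of_forall fun ω => abs_payoff_le hC0 hC _)
  simpa [expectedPayoff] using this

end TugOfWar

namespace TugOfWar

/-! ### Comparison of sub- and supersolutions of the dynamic programming equation. -/

section Comparison

variable {X : Type*} {R : X → X → Prop} {Y : Set X} {u v up um vp vm : X → ℝ} {p q M : ℝ}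

/-- At a point where `v - u` is within `τ` of its supremum, the local suprema of `v` and `u`
differ by almost the supremum of `v - u`. -/
theorem sub_le_sup_sub_sup (hp : 0 < p) (hq : 0 < q) (hpq : p + q = 1)
    (hvm : ∀ x, IsGLB (v '' {y | R x y}) (vm x)) (hum : ∀ x, IsGLB (u '' {y | R x y}) (um x))
    (hv : ∀ x ∉ Y, v x ≤ p * vp x + q * vm x) (hu : ∀ x ∉ Y, p * up x + q * um x ≤ u x)
    (hM : ∀ x, v x - u x ≤ M) {x : X} (hx : x ∉ Y) {τ : ℝ} (h : M - τ ≤ v x - u x) :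
    M - τ / p ≤ vp x - up x := by
  have h1 : vm x - M ≤ um x := (hum x).2 (by
    rintro _ ⟨y, hy, rfl⟩
    linarith [(hvm x).1 ⟨y, hy, rfl⟩, hM y])
  have h2 := hv x hx
  have h3 := hu x hx
  have h4 : q * (vm x - um x) ≤ q * M := by gcongr; linarith
  have h5 : p * M - τ ≤ p * (vp x - up x) := by
    have : q = 1 - p := by linarith
    subst this; linarith
  have h6 : p * (M - τ / p) = p * M - τ := by field_simp
  exact le_of_mul_le_mul_left (by linarith) hp

/-- Each step moves to a neighbour that nearly maximizes `v`, gaining almost `δ` and keeping almost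
the same slope; `n` steps gain at least half of the ideal `n * δ`. -/
theorem exists_large_value (hR : ∀ x, R x x) (hRs : ∀ x y, R x y → R y x)
    (hp : 0 < p) (hq : 0 < q) (hpq : p + q = 1) (hle : p ≤ q)
    (hvp : ∀ x, IsLUB (v '' {y | R x y}) (vp x)) (hvm : ∀ x, IsGLB (v '' {y | R x y}) (vm x))
    (hup : ∀ x, IsLUB (u '' {y | R x y}) (up x)) (hum : ∀ x, IsGLB (u '' {y | R x y}) (um x))
    (hv : ∀ x ∉ Y, v x ≤ p * vp x + q * vm x) (hu : ∀ x ∉ Y, p * up x + q * um x ≤ u x)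
    (hY : ∀ x ∈ Y, v x ≤ u x) (hM : ∀ x, v x - u x ≤ M) (hM0 : 0 < M) (n : ℕ) :
    ∀ δ > 0, ∃ τ > 0, ∀ x, M - τ ≤ v x - u x → δ ≤ vp x - v x → ∃ z, v x + n * δ / 2 ≤ v z := by
  induction n with
  | zero => exact fun δ _ => ⟨1, one_pos, fun x _ _ => ⟨x, by simp⟩⟩
  | succ n ih =>
    intro δ hδ
    have hn : (0 : ℝ) < n + 2 := by positivity
    -- The loss `κ` in gain and slope is chosen so that `(δ - κ) + n * (δ - κ) / 2` is exactly `(n +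
    -- 1) * δ / 2`.
    set κ := δ / (n + 2) with hκ
    have hκ0 : 0 < κ := by positivity
    have hκδ : (n + 2) * κ = δ := by rw [hκ]; field_simp
    have hn0 : (0 : ℝ) ≤ n := n.cast_nonneg
    obtain ⟨τ', hτ', H⟩ := ih (δ - κ) (by nlinarith)
    have hc : 0 < 1 + 1 / p := by positivity
    -- The deficit grows from `τ` at `x` to `τ + τ / p` at `z`: it must stay at most `τ'` for the
    -- induction hypothesis, and below `M` to keep `z` off `Y`.
    set τ := min κ (min (τ' / (1 + 1 / p)) (M / (2 * (1 + 1 / p)))) with hτ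
    have hτ0 : 0 < τ := by positivity
    have hτκ : τ ≤ κ := min_le_left _ _
    have hτ1 : τ * (1 + 1 / p) ≤ τ' := by
      rw [← le_div_iff₀ hc]; exact (min_le_right _ _).trans (min_le_left _ _)
    have hτ2 : τ * (1 + 1 / p) < M := by
      have : τ * (2 * (1 + 1 / p)) ≤ M := by
        rw [← le_div_iff₀ (by positivity)]; exact (min_le_right _ _).trans (min_le_right _ _)
      nlinarith [mul_pos hτ0 hc]
    have hτp : τ * (1 + 1 / p) = τ + τ / p := by ring
    refine ⟨τ, hτ0, fun x hx hxδ => ?_⟩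
    have hxY : x ∉ Y := fun h => by
      have : 0 < τ / p := by positivity
      linarith [hY x h]
    have hs := sub_le_sup_sub_sup hp hq hpq hvm hum hv hu hM hxY hx
    obtain ⟨_, ⟨z, hxz, rfl⟩, hz, -⟩ := (hvp x).exists_between (sub_lt_self _ hτ0)
    have huz : u z ≤ up x := (hup x).1 ⟨z, hxz, rfl⟩
    have hDz : M - (τ + τ / p) ≤ v z - u z := by linarith
    have hzY : z ∉ Y := fun h => by linarith [hY z h]
    have hvx : vm z ≤ v x := (hvm z).1 ⟨x, hRs _ _ hxz, rfl⟩
    have hvz : vm z ≤ v z := (hvm z).1 ⟨z, hR z, rfl⟩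
    -- As `p ≤ q`, the subsolution inequality forces the upward slope at `z` to dominate the
    -- downward one, which is at least `v z - v x` because `x` is a neighbour of `z`.
    have hslope : v z - vm z ≤ vp z - v z := by
      have h1 := hv z hzY
      have h2 : p * (v z - vm z) ≤ q * (v z - vm z) := by gcongr
      have h3 : p * (v z - vm z) ≤ p * (vp z - v z) := by
        have : q = 1 - p := by linarith
        subst this; linarith
      exact le_of_mul_le_mul_left h3 hp
    obtain ⟨w, hw⟩ := H z (by linarith) (by linarith)
    refine ⟨w, le_trans ?_ hw⟩
    push_cast
    have : (n + 1) * δ / 2 ≤ (δ - κ) + n * (δ - κ) / 2 := by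
      rw [← hκδ]; linarith
    linarith

theorem exists_slope_le (hR : ∀ x, R x x) (hRs : ∀ x y, R x y → R y x)
    (hp : 0 < p) (hq : 0 < q) (hpq : p + q = 1) (hle : p ≤ q)
    (hvp : ∀ x, IsLUB (v '' {y | R x y}) (vp x)) (hvm : ∀ x, IsGLB (v '' {y | R x y}) (vm x))
    (hup : ∀ x, IsLUB (u '' {y | R x y}) (up x)) (hum : ∀ x, IsGLB (u '' {y | R x y}) (um x))
    (hv : ∀ x ∉ Y, v x ≤ p * vp x + q * vm x) (hu : ∀ x ∉ Y, p * up x + q * um x ≤ u x)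
    (hY : ∀ x ∈ Y, v x ≤ u x) (hM : ∀ x, v x - u x ≤ M) (hM0 : 0 < M)
    {C : ℝ} (hC : ∀ x, |v x| ≤ C) {δ : ℝ} (hδ : 0 < δ) :
    ∃ τ > 0, ∀ x, M - τ ≤ v x - u x → vp x - v x ≤ δ := by
  obtain ⟨n, hn⟩ := exists_nat_gt (4 * C / δ)
  obtain ⟨τ, hτ, H⟩ :=
    exists_large_value hR hRs hp hq hpq hle hvp hvm hup hum hv hu hY hM hM0 n δ hδ
  refine ⟨τ, hτ, fun x hx => ?_⟩
  by_contra! hlt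
  obtain ⟨z, hz⟩ := H x hx hlt.le
  rw [div_lt_iff₀ hδ] at hn
  linarith [abs_le.1 (hC x), abs_le.1 (hC z)]

theorem le_of_subsolution_of_supersolution_of_le
    (hR : ∀ x, R x x) (hRs : ∀ x y, R x y → R y x)
    (hp : 0 < p) (hq : 0 < q) (hpq : p + q = 1) (hle : p ≤ q)
    (hvp : ∀ x, IsLUB (v '' {y | R x y}) (vp x)) (hvm : ∀ x, IsGLB (v '' {y | R x y}) (vm x))
    (hup : ∀ x, IsLUB (u '' {y | R x y}) (up x)) (hum : ∀ x, IsGLB (u '' {y | R x y}) (um x))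
    (hv : ∀ x ∉ Y, v x ≤ p * vp x + q * vm x) (hu : ∀ x ∉ Y, p * up x + q * um x ≤ u x)
    (hY : ∀ x ∈ Y, v x ≤ u x) {C : ℝ} (hCv : ∀ x, |v x| ≤ C) (hCu : ∀ x, |u x| ≤ C)
    {r : X → ℕ} {N : ℕ} (hr : ∀ x ∉ Y, ∃ y, R x y ∧ r y < r x) (hN : ∀ x, r x ≤ N) (x : X) :
    v x ≤ u x := by
  by_contra! hx
  have hb : BddAbove (Set.range fun x => v x - u x) := ⟨2 * C, by
    rintro _ ⟨y, rfl⟩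
    simp only
    linarith [abs_le.1 (hCv y), abs_le.1 (hCu y)]⟩
  set M := ⨆ x, v x - u x with hMdef
  have hM : ∀ x, v x - u x ≤ M := le_ciSup hb
  have hM0 : 0 < M := (sub_pos.2 hx).trans_le (hM x)
  -- A gap below `M` is propagated from `Y` to higher ranks; since ranks are bounded, it contradicts
  -- the definition of `M`.
  have key : ∀ n, ∃ τ > 0, ∀ x, r x ≤ n → v x - u x < M - τ := by
    intro n
    induction n with
    | zero =>
      refine ⟨M / 2, by positivity, fun x hx => ?_⟩
      have : x ∈ Y := by
        by_contra h
        obtain ⟨y, -, hy⟩ := hr x h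
        omega
      linarith [hY x this]
    | succ n ih =>
      obtain ⟨τ', hτ', H⟩ := ih
      obtain ⟨τ₁, hτ₁, H₁⟩ := exists_slope_le hR hRs hp hq hpq hle hvp hvm hup hum hv hu hY hM hM0
        hCv (δ := τ' / 4) (by positivity)
      -- At the neighbour `y` of lower rank the deficit is at most `τ' / 4` for each slope of `v` at
      -- `x` plus `τ / p ≤ τ' / 2`, in total `τ'`. The bound `M / 2` keeps `x` off `Y`.
      refine ⟨min τ₁ (min (τ' / 2 * p) (M / 2)), by positivity, fun x hx => ?_⟩
      by_contra! hD
      set τ := min τ₁ (min (τ' / 2 * p) (M / 2)) with hτ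
      have h1 : τ ≤ τ₁ := min_le_left _ _
      have h2 : τ ≤ τ' / 2 * p := (min_le_right _ _).trans (min_le_left _ _)
      have h3 : τ ≤ M / 2 := (min_le_right _ _).trans (min_le_right _ _)
      rw [← div_le_iff₀ hp] at h2
      have hxY : x ∉ Y := fun h => by linarith [hY x h]
      have hs := sub_le_sup_sub_sup hp hq hpq hvm hum hv hu hM hxY hD
      have hsl := H₁ x (by linarith)
      obtain ⟨y, hxy, hy⟩ := hr x hxY
      have h4 := H y (by omega)
      have h5 : u y ≤ up x := (hup x).1 ⟨y, hxy, rfl⟩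
      have h6 : vm x ≤ v y := (hvm x).1 ⟨y, hxy, rfl⟩
      have h7 : v x - vm x ≤ τ' / 4 := by
        have h8 := hv x hxY
        have h9 : p * (vp x - v x) ≤ q * (τ' / 4) := by
          calc p * (vp x - v x) ≤ p * (τ' / 4) := by gcongr
            _ ≤ q * (τ' / 4) := by gcongr
        have : q * (v x - vm x) ≤ q * (τ' / 4) := by
          have : p = 1 - q := by linarith
          subst this; linarith
        exact le_of_mul_le_mul_left this hq
      linarith
  obtain ⟨τ, hτ, H⟩ := key N
  have : M ≤ M - τ := by
    have : Nonempty X := ⟨x⟩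
    exact ciSup_le fun y => (H y (hN y)).le
  linarith

theorem isLUB_image_neg {s : Set X} {a : ℝ} (h : IsGLB (u '' s) a) :
    IsLUB ((fun x => -u x) '' s) (-a) := by
  have := h.neg
  rwa [← Set.image_neg_eq_neg, Set.image_image] at this

theorem isGLB_image_neg {s : Set X} {a : ℝ} (h : IsLUB (u '' s) a) :
    IsGLB ((fun x => -u x) '' s) (-a) := by
  have := h.neg
  rwa [← Set.image_neg_eq_neg, Set.image_image] at this

/-- The comparison principle for the dynamic programming equation of biased tug-of-war. -/
theorem le_of_subsolution_of_supersolution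
    (hR : ∀ x, R x x) (hRs : ∀ x y, R x y → R y x)
    (hp : 0 < p) (hq : 0 < q) (hpq : p + q = 1)
    (hvp : ∀ x, IsLUB (v '' {y | R x y}) (vp x)) (hvm : ∀ x, IsGLB (v '' {y | R x y}) (vm x))
    (hup : ∀ x, IsLUB (u '' {y | R x y}) (up x)) (hum : ∀ x, IsGLB (u '' {y | R x y}) (um x))
    (hv : ∀ x ∉ Y, v x ≤ p * vp x + q * vm x) (hu : ∀ x ∉ Y, p * up x + q * um x ≤ u x)
    (hY : ∀ x ∈ Y, v x ≤ u x) {C : ℝ} (hCv : ∀ x, |v x| ≤ C) (hCu : ∀ x, |u x| ≤ C)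
    {r : X → ℕ} {N : ℕ} (hr : ∀ x ∉ Y, ∃ y, R x y ∧ r y < r x) (hN : ∀ x, r x ≤ N) (x : X) :
    v x ≤ u x := by
  rcases le_total p q with hle | hle
  · exact le_of_subsolution_of_supersolution_of_le hR hRs hp hq hpq hle hvp hvm hup hum hv hu hY
      hCv hCu hr hN x
  -- Exchanging the players turns `-u` into the subsolution and `-v` into the supersolution, with
  -- `p` and `q` swapped.
  · have := le_of_subsolution_of_supersolution_of_le (Y := Y) (C := C) hR hRs hq hp
      (by linarith) hle
      (fun x => isLUB_image_neg (hum x)) (fun x => isGLB_image_neg (hup x))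
      (fun x => isLUB_image_neg (hvm x)) (fun x => isGLB_image_neg (hvp x))
      (fun x hx => by linarith [hu x hx]) (fun x hx => by linarith [hv x hx])
      (fun x hx => neg_le_neg (hY x hx)) (by simpa using hCu) (by simpa using hCv) hr hN x
    linarith

end Comparison

end TugOfWar

namespace TugOfWar

variable {X : Type*} [MetricSpace X] {ε : ℝ}

/-! ### Forcing the game to terminate -/

/-- The strategy that chooses the next position as a function of the current one. -/
def Strategy.stationary (g : X → X) (hg : ∀ x, dist (g x) x < ε) : Strategy X ε where
  move x₀ h := g (current x₀ h)
  dist_move_lt _ _ := hg _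

theorem Strategy.shift_stationary (g : X → X) (hg : ∀ x, dist (g x) x < ε) (b : Bool) (x : X) :
    (stationary g hg).shift b x = stationary g hg := by
  simp [shift, stationary, current_append]

theorem measureReal_not_terminates (θ : Set.Icc (-1 : ℝ) 1) {Y : Set X} (S₁ S₂ : Strategy X ε)
    {x : X} (hx : x ∉ Y) :
    (coinMeasure θ).real {ω | ∃ n, position S₁ S₂ x ω n ∈ Y}ᶜ =
      winProb θ * (coinMeasure θ).real
        {ω | ∃ n, position (S₁.shift true x) (S₂.shift true x) (S₁.move x []) ω n ∈ Y}ᶜ +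
      (1 - winProb θ) * (coinMeasure θ).real
        {ω | ∃ n, position (S₁.shift false x) (S₂.shift false x) (S₂.move x []) ω n ∈ Y}ᶜ := by
  have (b : Bool) : prepend b ⁻¹' {ω | ∃ n, position S₁ S₂ x ω n ∈ Y}ᶜ =
      {ω | ∃ n, position (S₁.shift b x) (S₂.shift b x) (firstMove S₁ S₂ x b) ω n ∈ Y}ᶜ := by
    ext ω
    exact not_congr (exists_position_prepend_iff S₁ S₂ hx b ω)
  rw [measureReal_coinMeasure θ (measurableSet_position_mem Y S₁ S₂ x).compl, this, this]
  rfl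

/-- If a function `a` of a position `x` and of some other parameter `s` is bounded and, outside
of `Y`, at most the average of a value at a position of lower rank and of some other value, where
the weights are bounded below, then it is nonpositive as soon as it is so in `Y`. -/
theorem nonpos_of_le_average {X σ : Type*} {Y : Set X} {a : σ → X → ℝ} {m : ℝ} (hm0 : 0 < m)
    (hm1 : m ≤ 1) (ha1 : ∀ s x, a s x ≤ 1)
    (haY : ∀ s, ∀ x ∈ Y, a s x ≤ 0) {r : X → ℕ} {N : ℕ} {g : X → X}
    (hr : ∀ x ∉ Y, r (g x) < r x) (hN : ∀ x, r x ≤ N)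
    (hstep : ∀ A, 0 ≤ A → (∀ s x, a s x ≤ A) →
      ∀ s, ∀ x ∉ Y, ∃ s', a s x ≤ m * a s' (g x) + (1 - m) * A) (s : σ) (x : X) :
    a s x ≤ 0 := by
  have hb : BddAbove (Set.range fun z : σ × X => a z.1 z.2) :=
    ⟨1, by rintro _ ⟨z, rfl⟩; exact ha1 _ _⟩
  by_contra! hpos
  set A := ⨆ z : σ × X, a z.1 z.2 with hA
  have hle (s x) : a s x ≤ A := le_ciSup hb (s, x)
  have hA0 : 0 < A := hpos.trans_le (hle s x)
  -- With weight at least `m ^ k`, the next `k` steps all lower the rank and so reach `Y`.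
  have key (k : ℕ) : ∀ s x, r x ≤ k → a s x ≤ (1 - m ^ k) * A := by
    induction k with
    | zero =>
      intro s x hx
      have : x ∈ Y := by
        by_contra h
        have := hr x h
        omega
      simpa using haY s x this
    | succ k ih =>
      intro s x hx
      by_cases hxY : x ∈ Y
      · refine (haY s x hxY).trans (mul_nonneg (sub_nonneg.2 ?_) hA0.le)
        exact pow_le_one₀ hm0.le hm1
      · obtain ⟨s', hs'⟩ := hstep A hA0.le hle s x hxY
        have h1 := ih s' (g x) (by have := hr x hxY; omega)
        have h2 : m * a s' (g x) ≤ m * ((1 - m ^ k) * A) := by gcongr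
        rw [pow_succ]
        linarith
  have : Nonempty (σ × X) := ⟨(s, x)⟩
  have hfin : A ≤ (1 - m ^ N) * A := ciSup_le fun z => key N z.1 z.2 (hN _)
  nlinarith [mul_pos (pow_pos hm0 N) hA0]

/-- `nonpos_of_le_average` is applied to the probability of never ending. Its extra parameter is the
opponent's strategy, which each round replaces by a shift; `m` is the chance that the stationary
player wins a toss. -/
theorem stationary_terminates {θ : Set.Icc (-1 : ℝ) 1} (h₁ : 0 < winProb θ) (h₂ : winProb θ < 1)
    {Y : Set X} {r : X → ℕ} {N : ℕ} {g : X → X} (hg : ∀ x, dist (g x) x < ε)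
    (hr : ∀ x ∉ Y, r (g x) < r x) (hN : ∀ x, r x ≤ N) (S : Strategy X ε) (x : X) :
    TerminatesAS θ Y (.stationary g hg) S x ∧ TerminatesAS θ Y S (.stationary g hg) x := by
  have hp : (0 : ℝ) < winProb θ := h₁
  have hq : (0 : ℝ) < 1 - winProb θ := sub_pos.2 h₂
  have hY (S₁ S₂ : Strategy X ε) (x) (hx : x ∈ Y) :
      (coinMeasure θ).real {ω | ∃ n, position S₁ S₂ x ω n ∈ Y}ᶜ ≤ 0 := by
    have : {ω | ∃ n, position S₁ S₂ x ω n ∈ Y} = Set.univ :=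
      Set.eq_univ_of_forall fun ω => ⟨0, hx⟩
    simp [this]
  have hterm {S₁ S₂ : Strategy X ε} {x : X}
      (h : (coinMeasure θ).real {ω | ∃ n, position S₁ S₂ x ω n ∈ Y}ᶜ ≤ 0) :
      TerminatesAS θ Y S₁ S₂ x :=
    mem_ae_iff.2 ((measureReal_eq_zero_iff).1 (h.antisymm measureReal_nonneg))
  constructor
  · refine hterm (nonpos_of_le_average (Y := Y) (a := fun S x => (coinMeasure θ).real
      {ω | ∃ n, position (.stationary g hg) S x ω n ∈ Y}ᶜ) hp (by linarith)
      (fun _ _ => measureReal_le_one) (fun S => hY _ S) hr hN (fun A _ hA S x hx => ?_) S x)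
    refine ⟨S.shift true x, ?_⟩
    rw [measureReal_not_terminates θ _ S hx, Strategy.shift_stationary, Strategy.shift_stationary]
    exact add_le_add le_rfl (mul_le_mul_of_nonneg_left (hA _ _) hq.le)
  · refine hterm (nonpos_of_le_average (Y := Y) (a := fun S x => (coinMeasure θ).real
      {ω | ∃ n, position S (.stationary g hg) x ω n ∈ Y}ᶜ) hq (by linarith)
      (fun _ _ => measureReal_le_one) (fun S => hY S _) hr hN (fun A _ hA S x hx => ?_) S x)
    refine ⟨S.shift false x, ?_⟩
    rw [measureReal_not_terminates θ S _ hx, Strategy.shift_stationary, Strategy.shift_stationary,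
      sub_sub_cancel, add_comm]
    exact add_le_add le_rfl (mul_le_mul_of_nonneg_left (hA _ _) hp.le)

/-! ### The guaranteed payoffs -/

/-- The strategy that makes the first move with `m`, and then plays the strategy `S y` for the game
that starts at the position `y` after the first round. -/
def Strategy.compose (m : X → X) (hm : ∀ x, dist (m x) x < ε) (S : X → Strategy X ε) :
    Strategy X ε where
  -- Histories list the latest round first, so the last entry is the first round.
  move x₀ h := match h.getLast? with
    | none => m x₀
    | some r => (S r.2).move r.2 h.dropLast
  dist_move_lt x₀ h := by
    rcases h.eq_nil_or_concat with rfl | ⟨h, ⟨b, y⟩, rfl⟩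
    · exact hm x₀
    · simpa [current_append] using (S y).dist_move_lt y h

theorem Strategy.shift_compose_move (m : X → X) (hm : ∀ x, dist (m x) x < ε) (S : X → Strategy X ε)
    (b : Bool) (x y : X) : ((compose m hm S).shift b x).move y = (S y).move y := by
  ext h
  simp [shift, compose]

theorem TerminatesAS.congr {θ : Set.Icc (-1 : ℝ) 1} {Y : Set X} {S₁ S₂ S₁' S₂' : Strategy X ε}
    {x : X} (h : TerminatesAS θ Y S₁' S₂' x) (h₁ : S₁.move x = S₁'.move x)
    (h₂ : S₂.move x = S₂'.move x) : TerminatesAS θ Y S₁ S₂ x := by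
  rwa [TerminatesAS, position_congr h₁ h₂]

theorem expectedPayoff_congr (θ : Set.Icc (-1 : ℝ) 1) (Y : Set X) (F : Y → ℝ)
    {S₁ S₂ S₁' S₂' : Strategy X ε} {x : X} (h₁ : S₁.move x = S₁'.move x)
    (h₂ : S₂.move x = S₂'.move x) :
    expectedPayoff θ Y F S₁ S₂ x = expectedPayoff θ Y F S₁' S₂' x := by
  rw [expectedPayoff, position_congr h₁ h₂, expectedPayoff]

/-- The payoffs that player I can guarantee. -/
def guaranteedI (ε : ℝ) (θ : Set.Icc (-1 : ℝ) 1) (Y : Set X) (F : Y → ℝ) (x : X) : Set ℝ :=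
  {c | ∃ S₁ : Strategy X ε, ∀ S₂ : Strategy X ε,
    TerminatesAS θ Y S₁ S₂ x ∧ c ≤ expectedPayoff θ Y F S₁ S₂ x}

/-- The payoffs that player II can guarantee not to exceed. -/
def guaranteedII (ε : ℝ) (θ : Set.Icc (-1 : ℝ) 1) (Y : Set X) (F : Y → ℝ) (x : X) : Set ℝ :=
  {c | ∃ S₂ : Strategy X ε, ∀ S₁ : Strategy X ε,
    TerminatesAS θ Y S₁ S₂ x ∧ expectedPayoff θ Y F S₁ S₂ x ≤ c}

theorem le_valueI {θ : Set.Icc (-1 : ℝ) 1} {Y : Set X} {F : Y → ℝ} {x : X} {c : ℝ}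
    (h : c ∈ guaranteedI ε θ Y F x) : (c : EReal) ≤ valueI ε θ Y F x := by
  obtain ⟨S₁, h⟩ := h
  refine le_iSup_of_le S₁ (le_iInf fun S₂ => ?_)
  rw [payoffMinus, if_pos (h S₂).1]
  exact_mod_cast (h S₂).2

theorem valueII_le {θ : Set.Icc (-1 : ℝ) 1} {Y : Set X} {F : Y → ℝ} {x : X} {c : ℝ}
    (h : c ∈ guaranteedII ε θ Y F x) : valueII ε θ Y F x ≤ c := by
  obtain ⟨S₂, h⟩ := h
  refine iInf_le_of_le S₂ (iSup_le fun S₁ => ?_)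
  rw [payoffPlus, if_pos (h S₁).1]
  exact_mod_cast (h S₁).2

theorem valueI_le_valueII (θ : Set.Icc (-1 : ℝ) 1) (Y : Set X) (F : Y → ℝ) (x : X) :
    valueI ε θ Y F x ≤ valueII ε θ Y F x := by
  refine (iSup_iInf_le_iInf_iSup _).trans (iInf_mono fun S₂ => iSup_mono fun S₁ => ?_)
  unfold payoffMinus payoffPlus
  split_ifs
  exacts [le_rfl, bot_le]

theorem compose_mem_guaranteedI {θ : Set.Icc (-1 : ℝ) 1} (h₁ : 0 < winProb θ)
    (h₂ : winProb θ < 1) {Y : Set X} {F : Y → ℝ} {C : ℝ} (hC0 : 0 ≤ C) (hC : ∀ y, |F y| ≤ C)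
    {m : X → X} (hm : ∀ x, dist (m x) x < ε) {c : X → ℝ} (hc : ∀ x, c x ∈ guaranteedI ε θ Y F x)
    {x : X} (hx : x ∉ Y) {b : ℝ} (hb : ∀ y, dist y x < ε → b ≤ c y) :
    winProb θ * c (m x) + (1 - winProb θ) * b ∈ guaranteedI ε θ Y F x := by
  choose S hS using hc
  refine ⟨.compose m hm S, fun S₂ => ⟨?_, ?_⟩⟩
  · rw [terminatesAS_iff h₁ h₂ _ _ hx]
    exact fun i => (hS _ (S₂.shift i x)).1.congr (Strategy.shift_compose_move m hm S i x _) rfl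
  · rw [expectedPayoff_eq θ hC0 hC _ _ hx]
    refine add_le_add (mul_le_mul_of_nonneg_left ?_ (winProb θ).2.1)
      (mul_le_mul_of_nonneg_left ?_ (sub_nonneg.2 (winProb θ).2.2))
    · rw [expectedPayoff_congr θ Y F (Strategy.shift_compose_move m hm S true x _) rfl]
      exact (hS _ _).2
    · rw [expectedPayoff_congr θ Y F (Strategy.shift_compose_move m hm S false x _) rfl]
      exact (hb _ (S₂.dist_move_lt x [])).trans (hS _ _).2

theorem compose_mem_guaranteedII {θ : Set.Icc (-1 : ℝ) 1} (h₁ : 0 < winProb θ)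
    (h₂ : winProb θ < 1) {Y : Set X} {F : Y → ℝ} {C : ℝ} (hC0 : 0 ≤ C) (hC : ∀ y, |F y| ≤ C)
    {m : X → X} (hm : ∀ x, dist (m x) x < ε) {c : X → ℝ} (hc : ∀ x, c x ∈ guaranteedII ε θ Y F x)
    {x : X} (hx : x ∉ Y) {b : ℝ} (hb : ∀ y, dist y x < ε → c y ≤ b) :
    winProb θ * b + (1 - winProb θ) * c (m x) ∈ guaranteedII ε θ Y F x := by
  choose S hS using hc
  refine ⟨.compose m hm S, fun S₁ => ⟨?_, ?_⟩⟩
  · rw [terminatesAS_iff h₁ h₂ _ _ hx]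
    exact fun i => (hS _ (S₁.shift i x)).1.congr rfl (Strategy.shift_compose_move m hm S i x _)
  · rw [expectedPayoff_eq θ hC0 hC _ _ hx]
    refine add_le_add (mul_le_mul_of_nonneg_left ?_ (winProb θ).2.1)
      (mul_le_mul_of_nonneg_left ?_ (sub_nonneg.2 (winProb θ).2.2))
    · rw [expectedPayoff_congr θ Y F rfl (Strategy.shift_compose_move m hm S true x _)]
      exact (hS _ _).2.trans (hb _ (S₁.dist_move_lt x []))
    · rw [expectedPayoff_congr θ Y F rfl (Strategy.shift_compose_move m hm S false x _)]
      exact (hS _ _).2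

/-- The game has a value as soon as `Y` can be reached from everywhere in a bounded number of
steps of length less than `ε`. -/
theorem valueI_eq_valueII {θ : Set.Icc (-1 : ℝ) 1} (h₁ : 0 < winProb θ) (h₂ : winProb θ < 1)
    (hε : 0 < ε) {Y : Set X} {F : Y → ℝ} {C : ℝ} (hC0 : 0 ≤ C) (hC : ∀ y, |F y| ≤ C)
    {r : X → ℕ} {N : ℕ} (hr : ∀ x ∉ Y, ∃ y, dist y x < ε ∧ r y < r x) (hN : ∀ x, r x ≤ N) :
    valueI ε θ Y F = valueII ε θ Y F := by
  have hg (x : X) : ∃ y, dist y x < ε ∧ (x ∉ Y → r y < r x) := by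
    by_cases hx : x ∈ Y
    · exact ⟨x, by simpa, fun h => absurd hx h⟩
    · exact (hr x hx).imp fun y hy => ⟨hy.1, fun _ => hy.2⟩
  choose g hg hgr using hg
  have hterm := stationary_terminates h₁ h₂ (Y := Y) hg hgr hN
  let S₀ : Strategy X ε := .stationary g hg
  have hp : (0 : ℝ) < winProb θ := h₁
  have hq : (0 : ℝ) < 1 - winProb θ := sub_pos.2 h₂
  have hE := abs_expectedPayoff_le (ε := ε) θ hC0 hC
  have hI0 (x : X) : -C ∈ guaranteedI ε θ Y F x :=
    ⟨S₀, fun S₂ => ⟨(hterm S₂ x).1, (abs_le.1 (hE _ _ _)).1⟩⟩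
  have hII0 (x : X) : C ∈ guaranteedII ε θ Y F x :=
    ⟨S₀, fun S₁ => ⟨(hterm S₁ x).2, (abs_le.1 (hE _ _ _)).2⟩⟩
  have hI1 (x : X) : ∀ c ∈ guaranteedI ε θ Y F x, c ≤ C := fun c ⟨S₁, h⟩ =>
    (h S₀).2.trans (abs_le.1 (hE _ _ _)).2
  have hII1 (x : X) : ∀ c ∈ guaranteedII ε θ Y F x, -C ≤ c := fun c ⟨S₂, h⟩ =>
    (abs_le.1 (hE _ _ _)).1.trans (h S₀).2
  let u (x : X) : ℝ := sSup (guaranteedI ε θ Y F x)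
  let v (x : X) : ℝ := sInf (guaranteedII ε θ Y F x)
  have hule {x : X} {c : ℝ} (h : c ∈ guaranteedI ε θ Y F x) : c ≤ u x := le_csSup ⟨C, hI1 x⟩ h
  have hvle {x : X} {c : ℝ} (h : c ∈ guaranteedII ε θ Y F x) : v x ≤ c := csInf_le ⟨-C, hII1 x⟩ h
  have huC (x : X) : |u x| ≤ C := abs_le.2 ⟨hule (hI0 x), csSup_le ⟨_, hI0 x⟩ (hI1 x)⟩
  have hvC (x : X) : |v x| ≤ C := abs_le.2 ⟨le_csInf ⟨_, hII0 x⟩ (hII1 x), hvle (hII0 x)⟩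
  have hex {w : X → ℝ} (hw : ∀ x, |w x| ≤ C) (x : X) :
      IsLUB (w '' {y | dist y x < ε}) (sSup (w '' {y | dist y x < ε})) ∧
      IsGLB (w '' {y | dist y x < ε}) (sInf (w '' {y | dist y x < ε})) := by
    have hne : (w '' {y | dist y x < ε}).Nonempty := ⟨w x, x, by simpa, rfl⟩
    refine ⟨isLUB_csSup hne ⟨C, ?_⟩, isGLB_csInf hne ⟨-C, ?_⟩⟩
    · rintro _ ⟨y, -, rfl⟩; exact (abs_le.1 (hw y)).2
    · rintro _ ⟨y, -, rfl⟩; exact (abs_le.1 (hw y)).1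
  have huv (x : X) : v x ≤ u x := by
    refine le_of_subsolution_of_supersolution (R := fun x y => dist y x < ε) (Y := Y)
      (p := winProb θ) (q := 1 - winProb θ) (fun x => by simpa)
      (fun x y h => by rwa [dist_comm]) hp hq (by ring)
      (fun x => (hex hvC x).1) (fun x => (hex hvC x).2)
      (fun x => (hex huC x).1) (fun x => (hex huC x).2) (fun x hx => ?_) (fun x hx => ?_)
      (fun x hx => ?_) hvC huC hr hN x
    -- Half of `η` pays for a nearly minimizing first move, half for nearly optimal strategies
    -- afterwards.
    · refine le_of_forall_pos_le_add fun η hη => ?_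
      have hm (x : X) : ∃ y, dist y x < ε ∧ v y < sInf (v '' {y | dist y x < ε}) + η / 2 := by
        obtain ⟨_, ⟨y, hy, rfl⟩, -, h⟩ :=
          (hex hvC x).2.exists_between (lt_add_of_pos_right _ (half_pos hη))
        exact ⟨y, hy, h⟩
      choose m hm hmv using hm
      have hc (x : X) : ∃ c ∈ guaranteedII ε θ Y F x, c < v x + η / 2 :=
        exists_lt_of_csInf_lt ⟨_, hII0 x⟩ (lt_add_of_pos_right _ (half_pos hη))
      choose c hc hcv using hc
      have h := hvle (compose_mem_guaranteedII h₁ h₂ hC0 hC hm hc hx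
        (b := sSup (v '' {y | dist y x < ε}) + η) fun y hy => by
          linarith [hcv y, (hex hvC x).1.1 ⟨y, hy, rfl⟩])
      have h' : (1 - winProb θ) * c (m x) ≤
          (1 - winProb θ) * (sInf (v '' {y | dist y x < ε}) + η) := by
        gcongr
        linarith [hcv (m x), hmv x]
      linarith
    · refine le_of_forall_pos_le_add fun η hη => ?_
      have hm (x : X) : ∃ y, dist y x < ε ∧ sSup (u '' {y | dist y x < ε}) - η / 2 < u y := by
        obtain ⟨_, ⟨y, hy, rfl⟩, h, -⟩ :=
          (hex huC x).1.exists_between (sub_lt_self _ (half_pos hη))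
        exact ⟨y, hy, h⟩
      choose m hm hmu using hm
      have hc (x : X) : ∃ c ∈ guaranteedI ε θ Y F x, u x - η / 2 < c :=
        exists_lt_of_lt_csSup ⟨_, hI0 x⟩ (sub_lt_self _ (half_pos hη))
      choose c hc hcu using hc
      have h := hule (compose_mem_guaranteedI h₁ h₂ hC0 hC hm hc hx
        (b := sInf (u '' {y | dist y x < ε}) - η) fun y hy => by
          linarith [hcu y, (hex huC x).2.1 ⟨y, hy, rfl⟩])
      have h' : winProb θ * (sSup (u '' {y | dist y x < ε}) - η) ≤ winProb θ * c (m x) := by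
        gcongr
        linarith [hcu (m x), hmu x]
      linarith
    · have hF := expectedPayoff_of_mem (ε := ε) θ F (x₀ := x) (h := hx)
      refine (hvle (c := F ⟨x, hx⟩) ⟨S₀, fun S₁ => ⟨terminatesAS_of_mem θ _ _ hx, ?_⟩⟩).trans
        (hule ⟨S₀, fun S₂ => ⟨terminatesAS_of_mem θ _ _ hx, ?_⟩⟩)
      exacts [(hF _ _).le, (hF _ _).ge]
  ext x
  refine (valueI_le_valueII θ Y F x).antisymm ?_
  have hv : valueII ε θ Y F x ≤ v x := by
    refine EReal.le_of_forall_lt_iff_le.1 fun c hc => ?_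
    obtain ⟨c', hc', h⟩ := exists_lt_of_csInf_lt ⟨_, hII0 x⟩ (EReal.coe_lt_coe_iff.1 hc)
    exact (valueII_le hc').trans (EReal.coe_le_coe_iff.2 h.le)
  have hu : u x ≤ valueI ε θ Y F x := by
    refine EReal.ge_of_forall_gt_iff_ge.1 fun c hc => ?_
    obtain ⟨c', hc', h⟩ := exists_lt_of_lt_csSup ⟨_, hI0 x⟩ (EReal.coe_lt_coe_iff.1 hc)
    exact (EReal.coe_le_coe_iff.2 h.le).trans (le_valueI hc')
  exact hv.trans ((EReal.coe_le_coe_iff.2 (huv x)).trans hu)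

end TugOfWar

/-- In a length space, one can move by less than `ε` so as to come closer to a point at distance
at least `ε` by at least `ε / 2`. -/
theorem IsLengthSpace.exists_dist_lt {X : Type*} [MetricSpace X] (hX : IsLengthSpace X) {ε : ℝ}
    (hε : 0 < ε) {x y : X} (h : ε ≤ dist x y) :
    ∃ z, dist z x < ε ∧ dist z y + ε / 2 ≤ dist x y := by
  have hlt : ⨅ γ : Path x y, eVariationOn γ Set.univ < ENNReal.ofReal (dist x y + ε / 4) := by
    rw [← hX x y, edist_dist]
    exact (ENNReal.ofReal_lt_ofReal_iff (by positivity)).2 (by linarith)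
  obtain ⟨γ, hγ⟩ := iInf_lt_iff.1 hlt
  -- The rest of the path has length less than `dist x y + ε / 4 - 3 / 4 * ε = dist x y - ε / 2`.
  obtain ⟨t, ht⟩ : ∃ t, dist (γ t) x = 3 / 4 * ε := by
    refine mem_range_of_exists_le_of_exists_ge (f := fun t => dist (γ t) x) (by fun_prop)
      ⟨0, ?_⟩ ⟨1, ?_⟩
    · simp [hε.le]
    · simp only [Path.target, dist_comm y x]; linarith
  refine ⟨γ t, by linarith, ?_⟩
  have hsum : edist x (γ t) + edist (γ t) y ≤ eVariationOn γ Set.univ := by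
    have h1 := eVariationOn.edist_le γ (s := Set.univ ∩ Set.Iic t) (x := 0) (y := t)
      ⟨trivial, t.2.1⟩ ⟨trivial, Set.self_mem_Iic⟩
    have h2 := eVariationOn.edist_le γ (s := Set.univ ∩ Set.Ici t) (x := t) (y := 1)
      ⟨trivial, Set.self_mem_Ici⟩ ⟨trivial, t.2.2⟩
    rw [γ.source] at h1
    rw [γ.target] at h2
    exact (add_le_add h1 h2).trans ((eVariationOn.add_le_union γ fun a ha b hb =>
      le_trans ha.2 hb.2).trans (eVariationOn.mono γ (Set.subset_univ _)))
  have h3 := hsum.trans_lt hγ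
  rw [edist_dist, edist_dist, ← ENNReal.ofReal_add dist_nonneg dist_nonneg,
    ENNReal.ofReal_lt_ofReal_iff (by positivity), dist_comm x, ht] at h3
  linarith

/-- The rank counts steps of length `ε / 2` to a fixed point of `Y`; compactness bounds it through
the diameter. -/
theorem IsLengthSpace.exists_rank {X : Type*} [MetricSpace X] [CompactSpace X]
    (hX : IsLengthSpace X) {Y : Set X} (hY : Y.Nonempty) {ε : ℝ} (hε : 0 < ε) :
    ∃ (r : X → ℕ) (N : ℕ), (∀ x ∉ Y, ∃ y, dist y x < ε ∧ r y < r x) ∧ ∀ x, r x ≤ N := by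
  obtain ⟨y₀, hy₀⟩ := hY
  refine ⟨fun x => ⌈dist x y₀ / (ε / 2)⌉₊, ⌈Metric.diam (Set.univ : Set X) / (ε / 2)⌉₊,
    fun x hx => ?_, fun x => ?_⟩
  · rcases lt_or_ge (dist x y₀) ε with h | h
    · refine ⟨y₀, by rwa [dist_comm], ?_⟩
      have : 0 < dist x y₀ := dist_pos.2 fun h => hx (h ▸ hy₀)
      simp only [dist_self, zero_div, Nat.ceil_zero, Nat.ceil_pos]
      positivity
    · obtain ⟨z, hz, hzy⟩ := hX.exists_dist_lt hε h
      refine ⟨z, hz, Nat.lt_of_succ_le ?_⟩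
      rw [Nat.succ_eq_add_one, ← Nat.ceil_add_one (by positivity)]
      refine Nat.ceil_mono ?_
      rw [div_add_one (by positivity)]
      gcongr
  · refine Nat.ceil_mono ?_
    gcongr
    exact Metric.dist_le_diam_of_mem isCompact_univ.isBounded trivial trivial

/-- The biased `ε`-tug-of-war game on a compact length space has a value. -/
theorem mainTheorem4 {X : Type*} [MetricSpace X] [CompactSpace X] (hX : IsLengthSpace X)
    (Y : Set X) (hY : IsClosed Y) (hYne : Y.Nonempty)
    (F : Y → ℝ) (hF : ∃ K : NNReal, LipschitzWith K F)
    (ε : ℝ) (hε : 0 < ε) (θ : ℝ) (hθ : θ ∈ Set.Ioo (-1 : ℝ) 1) :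
    TugOfWar.valueI ε ⟨θ, Set.Ioo_subset_Icc_self hθ⟩ Y F =
      TugOfWar.valueII ε ⟨θ, Set.Ioo_subset_Icc_self hθ⟩ Y F := by
  obtain ⟨K, hF⟩ := hF
  have : CompactSpace Y := isCompact_iff_compactSpace.1 hY.isCompact
  obtain ⟨C, hC⟩ := (isCompact_univ (X := Y)).exists_bound_of_continuousOn
    hF.continuous.continuousOn
  obtain ⟨r, N, hr, hN⟩ := hX.exists_rank hYne hε
  refine TugOfWar.valueI_eq_valueII ?_ ?_ hε (C := |C|) (abs_nonneg C)
    (fun y => (hC y trivial).trans (le_abs_self C)) hr hN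
  · exact Subtype.coe_lt_coe.1 (show (0 : ℝ) < (1 + θ) / 2 by linarith [hθ.1])
  · exact Subtype.coe_lt_coe.1 (show (1 + θ) / 2 < (1 : ℝ) by linarith [hθ.2])
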